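/- Let $\lambda=(\lambda_n)$ be a frequency, i.e. a strictly increasing, unbounded sequence of non-negative reals, and let $\ell\ge 0$. For $m\ge 0$ and complex coefficients $(a_n)$ put $R_x^{\lambda,m}(s)=\sum_{\lambda_n<x}a_ne^{-\lambda_ns}\left(1-\frac{\lambda_n}{x}\right)^m$ for $x>0$, $s\in\mathbb{C}$, and let $\sigma_c^{\lambda,m}\in[-\infty,\infty]$ be the infimum of all real $\sigma$ for which $\lim_{x\to\infty}R_x^{\lambda,m}(\sigma)$ exists. The Dirichlet series $\sum a_ne^{-\lambda_ns}$ is a $\lambda$-Riesz germ of a holomorphic function $f$ on $[\mathrm{Re}>0]=\{s\in\mathbb{C}:\mathrm{Re}\,s>0\}$ if for some $m\ge 0$ we have $\sigma_c^{\lambda,m}<\infty$ and $f(s)=\lim_{x\to\infty}R_x^{\lambda,m}(s)$ whenever $\mathrm{Re}\,s>\max(0,\sigma_c^{\lambda,m})$. Let $H_{\infty,\ell}^\lambda[\mathrm{Re}>0]$ be the space of all holomorphic $f:[\mathrm{Re}>0]\to\mathbb{C}$ that have a $\lambda$-Riesz germ and satisfy $$\sup_{\mathrm{Re}\,s>0}\frac{|f(s)|}{(1+|s|)^\ell}<\infty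 .$$ Theorem. Let $f\in H_{\infty,\ell}^\lambda[\mathrm{Re}>0]$ and put $$\|f\|_{\infty,\ell}=\sup_{\mathrm{Re}\,s>0}\left|\frac{f(s)}{(1+s)^\ell}\right| .$$ This supremum is finite and is equivalent to the one above: $$\sup_{\mathrm{Re}\,s>0}\frac{|f(s)|}{(1+|s|)^\ell}\le\|f\|_{\infty,\ell}\le 2^\ell\sup_{\mathrm{Re}\,s>0}\frac{|f(s)|}{(1+|s|)^\ell}.$$ The function $\sigma\mapsto\sup_{t\in\mathbb{R}}\left|\frac{f(\sigma+it)}{(1+\sigma+it)^\ell}\right|$ is non-increasing on $(0,\infty)$, and $$\|f\|_{\infty,\ell}=\lim_{\sigma\to 0^+}\ \sup_{t\in\mathbb{R}}\left|\frac{f(\sigma+it)}{(1+\sigma+it)^\ell}\right| .$$ -/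

import Mathlib

open Filter Topology Set

noncomputable section

/-- A frequency: a strictly increasing, non-negative real sequence that is unbounded
(equivalently, tends to infinity), so that every sum over `lam n < x` is finite. -/
structure IsFrequency (lam : ℕ → ℝ) : Prop where
  strictMono : StrictMono lam
  nonneg : ∀ n, 0 ≤ lam n
  tendsto_atTop : Tendsto lam atTop atTop

/-- The open right half-plane. -/
def rightHalfPlane : Set ℂ := {s : ℂ | 0 < s.re}

/-- The `(lam, k)`-Riesz mean at `x` and `s` of the formal Dirichlet series with coefficients `a`;
the sum runs over the finitely many `n` with `lam n < x`. -/
def rieszMean (lam : ℕ → ℝ) (k : ℝ) (a : ℕ → ℂ) (x : ℝ) (s : ℂ) : ℂ :=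
  ∑ᶠ (n : ℕ) (_ : lam n < x),
    a n * Complex.exp (-(lam n : ℂ) * s) * (((1 - lam n / x) ^ k : ℝ) : ℂ)

/-- `(lam, k)`-Riesz summability at the point `s`. -/
def RieszSummableAt (lam : ℕ → ℝ) (k : ℝ) (a : ℕ → ℂ) (s : ℂ) : Prop :=
  ∃ c : ℂ, Tendsto (fun x : ℝ => rieszMean lam k a x s) atTop (𝓝 c)

/-- The abscissa of `(lam, k)`-Riesz summability, an extended real number. -/
def rieszAbscissa (lam : ℕ → ℝ) (k : ℝ) (a : ℕ → ℂ) : EReal :=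
  sInf ((fun σ : ℝ => (σ : EReal)) '' {σ : ℝ | RieszSummableAt lam k a (σ : ℂ)})

/-- The Dirichlet series with coefficients `a` is a `lam`-Riesz germ of `f`: for some order
`m ≥ 0` its abscissa of summability is not `+∞`, and on the part of the right half-plane to the
right of that abscissa the Riesz means of order `m` converge to `f`. -/
def IsRieszGerm (lam : ℕ → ℝ) (a : ℕ → ℂ) (f : ℂ → ℂ) : Prop :=
  ∃ m : ℝ, 0 ≤ m ∧ rieszAbscissa lam m a < ⊤ ∧
    ∀ s ∈ rightHalfPlane, rieszAbscissa lam m a < (s.re : EReal) →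
      Tendsto (fun x : ℝ => rieszMean lam m a x s) atTop (𝓝 (f s))

/-- The space of functions that are holomorphic on the right half-plane, are generated by a
`lam`-Riesz germ, and satisfy `sup |f s| / (1 + |s|) ^ l < ∞` over the right half-plane.
(Only the restriction of `f` to the right half-plane matters.) -/
def HInfty (lam : ℕ → ℝ) (l : ℝ) : Set (ℂ → ℂ) :=
  {f | DifferentiableOn ℂ f rightHalfPlane ∧ (∃ a : ℕ → ℂ, IsRieszGerm lam a f) ∧
    BddAbove ((fun s : ℂ => ‖f s‖ / (1 + ‖s‖) ^ l) '' rightHalfPlane)}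

/-- The norm with weight `(1 + |s|) ^ l`. -/
def normAbs (l : ℝ) (f : ℂ → ℂ) : ℝ :=
  ⨆ s : rightHalfPlane, ‖f s‖ / (1 + ‖(s : ℂ)‖) ^ l

/-- The norm with the holomorphic weight `(1 + s) ^ l`. -/
def normHol (l : ℝ) (f : ℂ → ℂ) : ℝ :=
  ⨆ s : rightHalfPlane, ‖f s / (1 + (s : ℂ)) ^ (l : ℂ)‖

/-- The supremum of `|f s / (1 + s) ^ l|` over the vertical line `Re s = σ`. -/
def lineSup (l : ℝ) (f : ℂ → ℂ) (σ : ℝ) : ℝ :=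
  ⨆ t : ℝ, ‖f (σ + t * Complex.I) / (1 + (σ + t * Complex.I)) ^ (l : ℂ)‖

end

/-! For `Re s > 0` the weights `|1 + s|` and `1 + |s|` agree up to a factor 2, so the two norms are
equivalent and `g(s) = f(s) / (1 + s) ^ l` is bounded and holomorphic. Phragmén–Lindelöf on `Re s >
σ` then bounds `g` there by its supremum on the line `Re s = σ`. This gives monotonicity of the line
suprema, and it makes them exhaust the global supremum as `σ → 0+`. -/

theorem norm_one_add_le_one_add_norm (s : ℂ) : ‖1 + s‖ ≤ 1 + ‖s‖ := by
  simpa using norm_add_le (1 : ℂ) s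

/-- Since `Re s ≥ 0`, both `1` and `|s|` are at most `|1 + s|`. -/
theorem one_add_norm_le_two_mul_norm_one_add {s : ℂ} (hs : 0 ≤ s.re) :
    1 + ‖s‖ ≤ 2 * ‖1 + s‖ := by
  have h1 : 1 ≤ ‖1 + s‖ := by
    have := Complex.re_le_norm (1 + s)
    simp only [Complex.add_re, Complex.one_re] at this
    linarith
  have h2 : ‖s‖ ≤ ‖1 + s‖ := by
    rw [← sq_le_sq₀ (norm_nonneg _) (norm_nonneg _), Complex.sq_norm, Complex.sq_norm,
      Complex.normSq_apply, Complex.normSq_apply]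
    simp only [Complex.add_re, Complex.one_re, Complex.add_im, Complex.one_im]
    nlinarith
  linarith

theorem norm_div_one_add_cpow (f : ℂ → ℂ) (l : ℝ) (s : ℂ) :
    ‖f s / (1 + s) ^ (l : ℂ)‖ = ‖f s‖ / ‖1 + s‖ ^ l := by
  rw [norm_div, Complex.norm_cpow_real]

theorem norm_one_add_pos {s : ℂ} (hs : s ∈ rightHalfPlane) : 0 < ‖1 + s‖ := by
  have hs' : 0 < s.re := hs
  have := one_add_norm_le_two_mul_norm_one_add hs'.le
  have := norm_nonneg s
  linarith

theorem norm_div_rpow_le_norm_div_cpow (f : ℂ → ℂ) {l : ℝ} (hl : 0 ≤ l) {s : ℂ}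
    (hs : s ∈ rightHalfPlane) :
    ‖f s‖ / (1 + ‖s‖) ^ l ≤ ‖f s / (1 + s) ^ (l : ℂ)‖ := by
  rw [norm_div_one_add_cpow]
  have := norm_one_add_pos hs
  gcongr
  exact norm_one_add_le_one_add_norm s

theorem norm_div_cpow_le_two_rpow_mul (f : ℂ → ℂ) {l : ℝ} (hl : 0 ≤ l) {s : ℂ}
    (hs : s ∈ rightHalfPlane) :
    ‖f s / (1 + s) ^ (l : ℂ)‖ ≤ 2 ^ l * (‖f s‖ / (1 + ‖s‖) ^ l) := by
  have hs' : 0 < s.re := hs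
  have h0 := norm_one_add_pos hs
  rw [norm_div_one_add_cpow, ← mul_div_assoc, div_le_div_iff₀ (by positivity) (by positivity)]
  calc ‖f s‖ * (1 + ‖s‖) ^ l ≤ ‖f s‖ * (2 * ‖1 + s‖) ^ l := by
        gcongr
        exact one_add_norm_le_two_mul_norm_one_add hs'.le
    _ = 2 ^ l * ‖f s‖ * ‖1 + s‖ ^ l := by
        rw [Real.mul_rpow (by norm_num) h0.le]; ring

theorem differentiableOn_div_one_add_cpow {f : ℂ → ℂ} (hf : DifferentiableOn ℂ f rightHalfPlane)
    (l : ℝ) : DifferentiableOn ℂ (fun s => f s / (1 + s) ^ (l : ℂ)) rightHalfPlane := by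
  refine hf.div (DifferentiableOn.cpow_const (by fun_prop) fun s hs => ?_) fun s hs => ?_
  · have hs' : 0 < s.re := hs
    -- `1 + s` has positive real part, hence avoids the branch cut of the power.
    refine Or.inl ?_
    simp only [Complex.add_re, Complex.one_re]
    linarith
  · rw [← norm_ne_zero_iff, Complex.norm_cpow_real]
    exact (Real.rpow_pos_of_pos (norm_one_add_pos hs) l).ne'

/-- A bounded holomorphic function on the right half-plane is bounded to the right of a vertical
line by any bound on that line. -/
theorem norm_le_of_norm_le_on_vertical_line {g : ℂ → ℂ} (hg : DifferentiableOn ℂ g rightHalfPlane)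
    {B : ℝ} (hB : ∀ s ∈ rightHalfPlane, ‖g s‖ ≤ B) {σ C : ℝ} (hσ : 0 < σ)
    (hC : ∀ t : ℝ, ‖g (σ + t * Complex.I)‖ ≤ C) {s : ℂ} (hs : σ ≤ s.re) : ‖g s‖ ≤ C := by
  have hmem : ∀ z : ℂ, 0 ≤ z.re → (σ : ℂ) + z ∈ rightHalfPlane := fun z hz => by
    change 0 < ((σ : ℂ) + z).re
    simp only [Complex.add_re, Complex.ofReal_re]
    linarith
  -- After translation by `σ > 0` the closed half-plane lies in the domain of `g`, so continuity up
  -- to the boundary is free.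
  have hd : DiffContOnCl ℂ (fun z => g (σ + z)) {z : ℂ | 0 < z.re} := by
    apply DifferentiableOn.diffContOnCl
    rw [Complex.closure_setOfPred_lt_re]
    exact hg.comp (by fun_prop) fun z hz => hmem z hz
  -- The growth condition `O(exp (b * |z| ^ c))`, `c < 2`, is taken with `c = 1` and `b = 0`: it is
  -- plain boundedness.
  have key := PhragmenLindelof.right_half_plane_of_bounded_on_real (C := C) (z := s - σ) hd
    ⟨1, by norm_num, 0, ?_⟩ ?_ hC (by simpa using hs)
  · simpa using key
  · refine Asymptotics.IsBigO.of_bound B (eventually_inf_principal.2 (Eventually.of_forall ?_))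
    intro z hz
    simpa using hB _ (hmem z (le_of_lt hz))
  · refine isBoundedUnder_of_eventually_le (a := B) ?_
    filter_upwards [eventually_ge_atTop 0] with x hx
    exact hB _ (hmem x (by simpa using hx))

theorem mainTheorem10 (lam : ℕ → ℝ) (hlam : IsFrequency lam) (l : ℝ) (hl : 0 ≤ l)
    (f : ℂ → ℂ) (hf : f ∈ HInfty lam l) :
    BddAbove ((fun s : ℂ => ‖f s / (1 + s) ^ (l : ℂ)‖) '' rightHalfPlane) ∧
    (normAbs l f ≤ normHol l f ∧ normHol l f ≤ 2 ^ l * normAbs l f) ∧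
    AntitoneOn (lineSup l f) (Set.Ioi 0) ∧
    Tendsto (lineSup l f) (𝓝[>] 0) (𝓝 (normHol l f)) := by
  obtain ⟨hd, -, hbdd⟩ := hf
  have : Nonempty rightHalfPlane := ⟨⟨1, by simp [rightHalfPlane]⟩⟩
  have hbA : BddAbove (range fun s : rightHalfPlane => ‖f s‖ / (1 + ‖(s : ℂ)‖) ^ l) := by
    rwa [← image_eq_range (fun s : ℂ => ‖f s‖ / (1 + ‖s‖) ^ l) rightHalfPlane]
  have hleA : ∀ s ∈ rightHalfPlane, ‖f s‖ / (1 + ‖s‖) ^ l ≤ normAbs l f := fun s hs =>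
    le_ciSup hbA ⟨s, hs⟩
  have hup : ∀ s ∈ rightHalfPlane, ‖f s / (1 + s) ^ (l : ℂ)‖ ≤ 2 ^ l * normAbs l f :=
    fun s hs => (norm_div_cpow_le_two_rpow_mul f hl hs).trans
      (mul_le_mul_of_nonneg_left (hleA s hs) (by positivity))
  have hb : BddAbove ((fun s : ℂ => ‖f s / (1 + s) ^ (l : ℂ)‖) '' rightHalfPlane) :=
    ⟨_, forall_mem_image.2 hup⟩
  have hbH : BddAbove (range fun s : rightHalfPlane => ‖f s / (1 + (s : ℂ)) ^ (l : ℂ)‖) := by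
    rwa [← image_eq_range (fun s : ℂ => ‖f s / (1 + s) ^ (l : ℂ)‖) rightHalfPlane]
  have hleH : ∀ s ∈ rightHalfPlane, ‖f s / (1 + s) ^ (l : ℂ)‖ ≤ normHol l f := fun s hs =>
    le_ciSup hbH ⟨s, hs⟩
  have hmem : ∀ σ : ℝ, 0 < σ → ∀ t : ℝ, (σ + t * Complex.I : ℂ) ∈ rightHalfPlane :=
    fun σ hσ t => by simpa [rightHalfPlane] using hσ
  have hline : ∀ σ : ℝ, 0 < σ → ∀ s : ℂ, σ ≤ s.re →
      ‖f s / (1 + s) ^ (l : ℂ)‖ ≤ lineSup l f σ := fun σ hσ s hs =>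
    norm_le_of_norm_le_on_vertical_line (g := fun s => f s / (1 + s) ^ (l : ℂ))
      (differentiableOn_div_one_add_cpow hd l) hleH hσ
      (fun t => le_ciSup (f := fun t : ℝ =>
          ‖f (σ + t * Complex.I) / (1 + (σ + t * Complex.I)) ^ (l : ℂ)‖)
        ⟨normHol l f, forall_mem_range.2 fun t => hleH _ (hmem σ hσ t)⟩ t) hs
  refine ⟨hb, ⟨?_, ?_⟩, ?_, ?_⟩
  · exact ciSup_le fun s => (norm_div_rpow_le_norm_div_cpow f hl s.2).trans (hleH s s.2)
  · exact ciSup_le fun s => hup s s.2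
  · intro σ hσ τ hτ hστ
    exact ciSup_le fun t => hline σ hσ _ (by simpa using hστ)
  · refine tendsto_order.2 ⟨fun c hc => ?_, fun c hc => ?_⟩
    -- A point `s` with `|g(s)| > c` forces every line supremum with `σ < Re s` above `c`.
    · obtain ⟨s, hs⟩ := exists_lt_of_lt_ciSup hc
      have hs0 : 0 < (s : ℂ).re := s.2
      filter_upwards [Ioo_mem_nhdsGT hs0] with σ hσ
      exact hs.trans_le (hline σ hσ.1 s hσ.2.le)
    · filter_upwards [self_mem_nhdsWithin] with σ hσ
      exact (ciSup_le fun t => hleH _ (hmem σ hσ t)).trans_lt hc
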